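/- For a connected simple graph $G$ with $n\ge 2$ vertices let $\mu_1(G)\ge\mu_2(G)\ge\cdots\ge\mu_n(G)=0$ be the eigenvalues, counted with multiplicity, of its Laplacian matrix $L(G)=D(G)-A(G)$ (degree matrix minus adjacency matrix), and let $R_L(G)=\mu_1(G)/\mu_{n-1}(G)$ be its Laplacian spectral ratio. For integers $\Delta\ge 3$ and $\mathcal D\ge 3$ let $T_{\Delta,\mathcal D}$ be the caterpillar tree obtained from a path $v_1v_2\cdots v_{\mathcal D-1}$ by attaching $\Delta-2$ pendant vertices to each vertex $v_i$, $1\le i\le \mathcal D-1$; it has $n=(\Delta-1)(\mathcal D-1)$ vertices and diameter $\mathcal D$, its vertices satisfy $d(v_1)=d(v_{\mathcal D-1})=\Delta-1$ and $d(v_2)=\cdots=d(v_{\mathcal D-2})=\Delta$, and its maximum degree is $\Delta$ when $\mathcal D\ge 4$. Let $P_n$ and $K_{1,n-1}$ denote the path and the star with $n$ vertices. If $n\ge 5$, then $$R_L(K_{1,n-1})<R_L(T_{\Delta,\mathcal D})<R_L(P_n).$$ -/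

import Mathlib

open Classical in
/-- The `k`-th largest Laplacian eigenvalue `μ_k(G)` of a graph `G` with `n` vertices, for
`1 ≤ k ≤ n`, so that `μ_1(G) ≥ μ_2(G) ≥ ⋯ ≥ μ_n(G)`, counted with multiplicity (and the value `0`
for all other `k`). The function `eigenvalues₀` lists the eigenvalues in decreasing order,
starting from index `0`. -/
noncomputable def laplacianEigenvalue {V : Type*} [Fintype V]
    (G : SimpleGraph V) (k : ℕ) : ℝ :=
  if h : 1 ≤ k ∧ k ≤ Fintype.card V then
    (G.isHermitian_lapMatrix ℝ).eigenvalues₀ ⟨k - 1, by omega⟩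
  else 0

/-- The Laplacian spectral ratio `R_L(G) = μ_1(G) / μ_{n-1}(G)` of a graph with `n` vertices: the
largest Laplacian eigenvalue divided by the second smallest one. -/
noncomputable def laplacianSpectralRatio {V : Type*} [Fintype V]
    (G : SimpleGraph V) : ℝ :=
  laplacianEigenvalue G 1 / laplacianEigenvalue G (Fintype.card V - 1)

/-- The caterpillar `T_{Δ,D}`. Its spine is a path on the `D - 1` vertices `(i, 0)`, and
`Δ - 2` pendant vertices `(i, j)`, `j ≠ 0`, are attached to each spine vertex `(i, 0)`.
It has `(Δ - 1) * (D - 1)` vertices; the two end vertices of the spine have degree `Δ - 1`, the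
other spine vertices have degree `Δ`. -/
def caterpillar (Δ D : ℕ) : SimpleGraph (Fin (D - 1) × Fin (Δ - 1)) where
  Adj u v :=
    ((u.2 : ℕ) = 0 ∧ (v.2 : ℕ) = 0 ∧
      ((u.1 : ℕ) + 1 = (v.1 : ℕ) ∨ (v.1 : ℕ) + 1 = (u.1 : ℕ))) ∨
    (u.1 = v.1 ∧ (((u.2 : ℕ) = 0 ∧ (v.2 : ℕ) ≠ 0) ∨ ((u.2 : ℕ) ≠ 0 ∧ (v.2 : ℕ) = 0)))
  symm := by
    constructor
    rintro u v (⟨hu, hv, h⟩ | ⟨h, h'⟩)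
    · exact Or.inl ⟨hv, hu, h.symm⟩
    · exact Or.inr ⟨h.symm, h'.symm.imp And.symm And.symm⟩
  loopless := by
    constructor
    rintro u (⟨_, _, h⟩ | ⟨_, h⟩) <;> omega

/-! Put `s = Δ - 1 = t + 1` and `m = D - 1`, so `n = s * m`. The leaf equations give `(1 - a) * leaf
= spine`. Eliminating the leaves shows that every caterpillar eigenvalue `a ≠ 1` solves `a ^ 2 - (s
+ θ) * a + θ = 0` for some eigenvalue `θ` of the spine `P_m`; conversely all such roots occur. For
`θ > 0` the roots lie on either side of `1` and have product `θ`. Hence `μ_1` is the larger root `x`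
over `Θ = 2 + 2 cos (π / m)`, and `μ_{n-1} = θ / y`, where `y` is the larger root over `θ = 2 - 2
cos (π / m)`. The ratio is `x * y / θ`, and a larger root lies within `1` below the sum of the
roots, so `(t + Θ) * (t + θ) < x * y < (s + Θ) * (s + θ)`. The star has ratio `n`, and the path has
the explicit ratio in `laplacianSpectralRatio_pathGraph`; elementary bounds on the cosine then
finish. Only `t = 1`, `m = 3` needs sharper values of `x` and `y`. -/

open Classical in
/-- `f` satisfies the eigenvalue equation of the Laplacian of `G` for the value `a`. -/
def IsLapEigenfunction {V : Type*} [Fintype V] (G : SimpleGraph V) (a : ℝ) (f : V → ℝ) : Prop :=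
  ∀ v, ∑ w, (if G.Adj v w then f v - f w else 0) = a * f v

/-- `a` is an eigenvalue of the Laplacian of `G`. -/
def IsLapEigenvalue {V : Type*} [Fintype V] (G : SimpleGraph V) (a : ℝ) : Prop :=
  ∃ f, f ≠ 0 ∧ IsLapEigenfunction G a f

/-! ### Extreme nonzero Laplacian eigenvalues -/

section Generic

variable {V : Type*} [Fintype V] {G : SimpleGraph V}

open Classical in
theorem isLapEigenfunction_iff_mulVec {a : ℝ} {f : V → ℝ} :
    IsLapEigenfunction G a f ↔ Matrix.mulVec (G.lapMatrix ℝ) f = a • f := by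
  rw [funext_iff]
  refine forall_congr' fun v => ?_
  rw [SimpleGraph.lapMatrix_mulVec_apply, SimpleGraph.degree_eq_sum_if_adj, Finset.sum_mul,
    SimpleGraph.neighborFinset_eq_filter, Finset.sum_filter, ← Finset.sum_sub_distrib,
    Pi.smul_apply, smul_eq_mul]
  refine Eq.congr (Finset.sum_congr rfl fun w _ => ?_) rfl
  split_ifs <;> simp

open Classical in
theorem isLapEigenfunction_eigenvectorBasis (i : V) :
    IsLapEigenfunction G ((G.isHermitian_lapMatrix ℝ).eigenvalues i)
      ((G.isHermitian_lapMatrix ℝ).eigenvectorBasis i) :=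
  isLapEigenfunction_iff_mulVec.2 ((G.isHermitian_lapMatrix ℝ).mulVec_eigenvectorBasis i)

open Classical in
theorem isLapEigenvalue_iff {a : ℝ} :
    IsLapEigenvalue G a ↔ ∃ i, (G.isHermitian_lapMatrix ℝ).eigenvalues i = a := by
  constructor
  · rintro ⟨f, hf, h⟩
    rw [isLapEigenfunction_iff_mulVec] at h
    have hs : a ∈ spectrum ℝ (G.lapMatrix ℝ) := by
      rw [← Matrix.spectrum_toLin']
      refine (Module.End.hasEigenvalue_of_hasEigenvector (x := f) ⟨?_, hf⟩).mem_spectrum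
      rw [Module.End.mem_eigenspace_iff, Matrix.toLin'_apply, h]
    rw [(G.isHermitian_lapMatrix ℝ).spectrum_real_eq_range_eigenvalues] at hs
    exact hs
  · rintro ⟨i, rfl⟩
    refine ⟨_, fun h => ?_, isLapEigenfunction_eigenvectorBasis i⟩
    apply (G.isHermitian_lapMatrix ℝ).eigenvectorBasis.toBasis.ne_zero i
    ext v
    simpa using congrFun h v

open Classical in
theorem isLapEigenvalue_iff_eigenvalues₀ {a : ℝ} :
    IsLapEigenvalue G a ↔ ∃ i, (G.isHermitian_lapMatrix ℝ).eigenvalues₀ i = a := by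
  rw [isLapEigenvalue_iff]
  exact (Fintype.equivOfCardEq (Fintype.card_fin _)).symm.exists_congr_left.trans
    (by simp [Matrix.IsHermitian.eigenvalues])

theorem IsLapEigenvalue.nonneg {a : ℝ} (h : IsLapEigenvalue G a) : 0 ≤ a := by
  classical
  obtain ⟨i, rfl⟩ := isLapEigenvalue_iff.1 h
  exact (SimpleGraph.posSemidef_lapMatrix ℝ G).eigenvalues_nonneg i

theorem isLapEigenvalue_zero [Nonempty V] : IsLapEigenvalue G 0 :=
  ⟨fun _ => 1, fun h => one_ne_zero (congrFun h (Classical.arbitrary V)), fun v => by simp⟩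

theorem laplacianEigenvalue_one_eq {a : ℝ} (ha : IsLapEigenvalue G a)
    (hmax : ∀ b, IsLapEigenvalue G b → b ≤ a) : laplacianEigenvalue G 1 = a := by
  classical
  obtain ⟨i, hi⟩ := isLapEigenvalue_iff_eigenvalues₀.1 ha
  have hc : 1 ≤ 1 ∧ 1 ≤ Fintype.card V := ⟨le_rfl, by have := i.2; omega⟩
  rw [laplacianEigenvalue, dif_pos hc]
  refine le_antisymm (hmax _ (isLapEigenvalue_iff_eigenvalues₀.2 ⟨_, rfl⟩)) (hi ▸ ?_)
  exact (G.isHermitian_lapMatrix ℝ).eigenvalues₀_antitone (Fin.le_def.2 (Nat.zero_le _))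

open Classical in
/-- If the kernel of the Laplacian consists of the constants, then `0` is a simple eigenvalue. -/
theorem eigenvalues₀_eq_zero_unique
    (hker : ∀ f, IsLapEigenfunction G 0 f → ∀ u v, f u = f v) {i j : Fin (Fintype.card V)}
    (hi : (G.isHermitian_lapMatrix ℝ).eigenvalues₀ i = 0)
    (hj : (G.isHermitian_lapMatrix ℝ).eigenvalues₀ j = 0) : i = j := by
  by_contra hij
  set e : Fin (Fintype.card V) ≃ V := Fintype.equivOfCardEq (Fintype.card_fin _) with he
  set b := (G.isHermitian_lapMatrix ℝ).eigenvectorBasis with hb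
  have hconst : ∀ k, (G.isHermitian_lapMatrix ℝ).eigenvalues₀ k = 0 →
      ∀ u v, b (e k) u = b (e k) v := by
    intro k hk
    refine hker _ ?_
    have := isLapEigenfunction_eigenvectorBasis (G := G) (e k)
    rwa [Matrix.IsHermitian.eigenvalues, ← he, Equiv.symm_apply_apply, hk] at this
  have horth := b.orthonormal.2 (e.injective.ne hij)
  have h1 : ∀ k, (G.isHermitian_lapMatrix ℝ).eigenvalues₀ k = 0 → b (e k) (e i) ≠ 0 := by
    intro k hk h0
    refine b.toBasis.ne_zero (e k) ?_
    ext v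
    simpa [hconst k hk v (e i)] using h0
  -- Two nonzero constant vectors cannot be orthogonal.
  have h2 : inner ℝ (b (e i)) (b (e j)) =
      Fintype.card V * (b (e j) (e i) * b (e i) (e i)) := by
    rw [PiLp.inner_apply]
    simp only [hconst i hi _ (e i), hconst j hj _ (e i)]
    simp
  have h3 : (Fintype.card V : ℝ) ≠ 0 := by
    have := i.2
    exact_mod_cast (by omega : Fintype.card V ≠ 0)
  exact mul_ne_zero h3 (mul_ne_zero (h1 j hj) (h1 i hi)) (h2.symm.trans horth)

theorem laplacianEigenvalue_card_sub_one_eq {a : ℝ}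
    (hker : ∀ f, IsLapEigenfunction G 0 f → ∀ u v, f u = f v)
    (ha : IsLapEigenvalue G a) (ha0 : a ≠ 0)
    (hmin : ∀ b, IsLapEigenvalue G b → b ≠ 0 → a ≤ b) :
    laplacianEigenvalue G (Fintype.card V - 1) = a := by
  classical
  obtain ⟨i, hi⟩ := isLapEigenvalue_iff_eigenvalues₀.1 ha
  have : Nonempty V := Fintype.card_pos_iff.1 (by have := i.2; omega)
  obtain ⟨j, hj⟩ := isLapEigenvalue_iff_eigenvalues₀.1 (isLapEigenvalue_zero (G := G))
  have hanti := (G.isHermitian_lapMatrix ℝ).eigenvalues₀_antitone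
  have hij : i < j := by
    by_contra h
    have h1 := hanti (not_lt.1 h)
    rw [hi, hj] at h1
    exact ha0 (le_antisymm h1 ha.nonneg)
  have hi2 := Fin.lt_def.1 hij
  have hj2 := j.2
  have hc : 1 ≤ Fintype.card V - 1 ∧ Fintype.card V - 1 ≤ Fintype.card V := by omega
  rw [laplacianEigenvalue, dif_pos hc]
  refine le_antisymm (hi ▸ hanti (Fin.le_def.2 (show (i : ℕ) ≤ Fintype.card V - 1 - 1 by omega)))
    (hmin _ (isLapEigenvalue_iff_eigenvalues₀.2 ⟨_, rfl⟩) fun h0 => ?_)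
  -- If `μ_{n-1}`, at index `card V - 2`, were zero, then so would be the last entry, against
  -- simplicity of `0`.
  have hlast : (G.isHermitian_lapMatrix ℝ).eigenvalues₀ ⟨Fintype.card V - 1, by omega⟩ = 0 := by
    refine le_antisymm (hj ▸ hanti (Fin.le_def.2 ?_))
      (isLapEigenvalue_iff_eigenvalues₀.2 ⟨_, rfl⟩ : IsLapEigenvalue G _).nonneg
    show (j : ℕ) ≤ Fintype.card V - 1
    omega
  have h := congrArg Fin.val (eigenvalues₀_eq_zero_unique hker h0 hlast)
  simp only at h
  omega

end Generic

/-! ### The spectrum of the path -/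

section Path

open Real

open Classical in
theorem sum_pathGraph_adj {m : ℕ} (F : ℕ → ℝ) (v : Fin m) :
    ∑ w : Fin m, (if (SimpleGraph.pathGraph m).Adj v w then F v - F w else 0) =
      (if (v : ℕ) + 1 < m then F v - F (v + 1) else 0) +
        (if 0 < (v : ℕ) then F v - F (v - 1) else 0) := by
  have hsplit : ∀ w : Fin m, (if (SimpleGraph.pathGraph m).Adj v w then F v - F w else 0) =
      (if (v : ℕ) + 1 = w then F v - F w else 0) +
        (if (w : ℕ) + 1 = v then F v - F w else 0) := by
    intro w
    rw [SimpleGraph.pathGraph_adj]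
    by_cases h1 : (v : ℕ) + 1 = w
    · have h2 : ¬ (w : ℕ) + 1 = v := by omega
      simp [h1, h2]
    · simp [h1]
  have hv := v.2
  rw [Finset.sum_congr rfl fun w _ => hsplit w, Finset.sum_add_distrib,
    Fin.sum_univ_eq_sum_range (fun w => if (v : ℕ) + 1 = w then F v - F w else 0) m,
    Fin.sum_univ_eq_sum_range (fun w => if w + 1 = (v : ℕ) then F v - F w else 0) m]
  congr 1
  · rw [Finset.sum_ite_eq]
    simp
  · split_ifs with h0
    · rw [Finset.sum_eq_single ((v : ℕ) - 1)]
      · rw [if_pos (by omega)]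
      · intro b _ hb
        rw [if_neg (by omega)]
      · intro hb
        rw [Finset.mem_range] at hb
        omega
    · exact Finset.sum_eq_zero fun w _ => if_neg (by omega)

/-- Cosines sampled at odd multiples of `t` are symmetric about the left end; `ht` makes them
symmetric about the right end too. A missing neighbour may thus be replaced by a mirror value,
contributing zero. -/
theorem isLapEigenfunction_pathGraph {m : ℕ} {t : ℝ} (ht : sin (2 * m * t) = 0) :
    IsLapEigenfunction (SimpleGraph.pathGraph m) (2 - 2 * cos (2 * t))
      (fun j => cos ((2 * (j : ℕ) + 1) * t)) := by
  intro v
  have hv := v.2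
  refine (sum_pathGraph_adj (fun j => cos ((2 * (j : ℝ) + 1) * t)) v).trans ?_
  simp only [Nat.cast_add, Nat.cast_one]
  have h1 : (if (v : ℕ) + 1 < m then
      cos ((2 * ((v : ℕ) : ℝ) + 1) * t) - cos ((2 * (((v : ℕ) : ℝ) + 1) + 1) * t) else 0) =
      cos ((2 * ((v : ℕ) : ℝ) + 1) * t) - cos ((2 * (((v : ℕ) : ℝ) + 1) + 1) * t) := by
    split_ifs with h
    · rfl
    · have hm : (m : ℝ) = ((v : ℕ) : ℝ) + 1 := by exact_mod_cast (by omega : m = (v : ℕ) + 1)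
      have e1 : (2 * ((v : ℕ) : ℝ) + 1) * t = 2 * m * t - t := by rw [hm]; ring
      have e2 : (2 * (((v : ℕ) : ℝ) + 1) + 1) * t = 2 * m * t + t := by rw [hm]; ring
      rw [e1, e2, cos_sub, cos_add, ht]
      ring
  have h2 : (if 0 < (v : ℕ) then
      cos ((2 * ((v : ℕ) : ℝ) + 1) * t) - cos ((2 * (((v : ℕ) - 1 : ℕ) : ℝ) + 1) * t) else 0) =
      cos ((2 * ((v : ℕ) : ℝ) + 1) * t) - cos ((2 * ((v : ℕ) : ℝ) + 1) * t - 2 * t) := by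
    split_ifs with h
    · rw [Nat.cast_sub (by omega)]
      congr 2
      push_cast
      ring
    · have h0 : (v : ℕ) = 0 := by omega
      rw [h0, ← cos_neg (_ - 2 * t)]
      simp only [Nat.cast_zero]
      rw [sub_eq_zero.2]
      congr 1
      ring
  rw [h1, h2, show (2 * (((v : ℕ) : ℝ) + 1) + 1) * t = (2 * ((v : ℕ) : ℝ) + 1) * t + 2 * t by ring,
    cos_add, cos_sub]
  ring

theorem isLapEigenvalue_pathGraph_of_lt {m k : ℕ} (hk : k < m) :
    IsLapEigenvalue (SimpleGraph.pathGraph m) (2 - 2 * cos (k * π / m)) := by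
  have hm : (0 : ℝ) < m := by exact_mod_cast (by omega : 0 < m)
  have ht : 2 * (m : ℝ) * (k * π / (2 * m)) = k * π := by field_simp
  have h := isLapEigenfunction_pathGraph (m := m) (t := k * π / (2 * m))
    (by rw [ht]; exact sin_nat_mul_pi k)
  rw [show 2 * (k * π / (2 * (m : ℝ))) = k * π / m by field_simp] at h
  refine ⟨_, fun h0 => ?_, h⟩
  have h1 := congrFun h0 ⟨0, by omega⟩
  simp only [Pi.zero_apply, Nat.cast_zero, mul_zero, zero_add, one_mul] at h1
  refine (cos_pos_of_mem_Ioo ⟨?_, ?_⟩).ne' h1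
  · have : 0 ≤ k * π / (2 * (m : ℝ)) := by positivity
    linarith [pi_pos]
  · rw [div_lt_div_iff₀ (by positivity) two_pos]
    have : (k : ℝ) < m := by exact_mod_cast hk
    nlinarith [pi_pos]

/-- The `m` listed values are distinct because cosine is injective on `[0, π]`, and a matrix of
order `m` has no room for more. -/
theorem isLapEigenvalue_pathGraph_iff {m : ℕ} {a : ℝ} :
    IsLapEigenvalue (SimpleGraph.pathGraph m) a ↔ ∃ k < m, a = 2 - 2 * cos (k * π / m) := by
  classical
  refine ⟨fun ha => ?_, fun ⟨k, hk, h⟩ => h ▸ isLapEigenvalue_pathGraph_of_lt hk⟩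
  obtain ⟨e, he⟩ : ∃ e : Fin m → ℝ, ∀ b, IsLapEigenvalue (SimpleGraph.pathGraph m) b ↔
      ∃ i, e i = b := ⟨_, fun _ => isLapEigenvalue_iff⟩
  set g : Fin m → ℝ := fun k => 2 - 2 * cos (k * π / m) with hg
  have hinj : Function.Injective g := by
    intro i j hij
    have hm : (0 : ℝ) < m := by exact_mod_cast (by have := i.2; omega : 0 < m)
    have hmem : ∀ k : Fin m, (k : ℝ) * π / m ∈ Set.Icc 0 π := by
      intro k
      have hk : ((k : ℕ) : ℝ) ≤ m := by exact_mod_cast k.2.le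
      refine ⟨by positivity, ?_⟩
      rw [div_le_iff₀ hm, mul_comm]
      exact mul_le_mul_of_nonneg_left hk pi_pos.le
    have h := injOn_cos (hmem i) (hmem j) (by simp only [hg] at hij; linarith)
    rw [div_left_inj' hm.ne', mul_left_inj' pi_ne_zero] at h
    exact Fin.ext (by exact_mod_cast h)
  have hsub : Finset.univ.image g ⊆ Finset.univ.image e := by
    intro x hx
    obtain ⟨k, -, rfl⟩ := Finset.mem_image.1 hx
    obtain ⟨i, hi⟩ := (he _).1 (isLapEigenvalue_pathGraph_of_lt k.2)
    exact Finset.mem_image.2 ⟨i, Finset.mem_univ _, hi⟩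
  have heq := Finset.eq_of_subset_of_card_le hsub
    (by rw [Finset.card_image_of_injective _ hinj]; exact Finset.card_image_le)
  obtain ⟨i, hi⟩ := (he _).1 ha
  have : a ∈ Finset.univ.image g := heq ▸ Finset.mem_image.2 ⟨i, Finset.mem_univ _, hi⟩
  obtain ⟨k, -, hk⟩ := Finset.mem_image.1 this
  exact ⟨k, k.2, hk.symm⟩

theorem IsLapEigenvalue.le_of_pathGraph {m : ℕ} {a : ℝ}
    (h : IsLapEigenvalue (SimpleGraph.pathGraph m) a) : a ≤ 2 + 2 * cos (π / m) := by
  obtain ⟨k, hk, rfl⟩ := isLapEigenvalue_pathGraph_iff.1 h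
  have hm : (1 : ℝ) ≤ m := by exact_mod_cast (by omega : 1 ≤ m)
  have hm0 : (0 : ℝ) < m := by linarith
  have hk' : (k : ℝ) + 1 ≤ m := by exact_mod_cast hk
  have h1 : cos (π - π / m) ≤ cos (k * π / m) := by
    refine cos_le_cos_of_nonneg_of_le_pi (by positivity) ?_ ?_
    · linarith [div_pos pi_pos hm0]
    · rw [div_le_iff₀ hm0, sub_mul, div_mul_cancel₀ _ hm0.ne']
      nlinarith [pi_pos]
  rw [cos_pi_sub] at h1
  linarith

theorem IsLapEigenvalue.ge_of_pathGraph {m : ℕ} {a : ℝ}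
    (h : IsLapEigenvalue (SimpleGraph.pathGraph m) a) (ha : a ≠ 0) :
    2 - 2 * cos (π / m) ≤ a := by
  obtain ⟨k, hk, rfl⟩ := isLapEigenvalue_pathGraph_iff.1 h
  have hm0 : (0 : ℝ) < m := by exact_mod_cast (by omega : 0 < m)
  have hk' : (k : ℝ) ≤ m := by exact_mod_cast hk.le
  have hk0 : k ≠ 0 := by
    rintro rfl
    simp at ha
  have hk1 : (1 : ℝ) ≤ k := by exact_mod_cast Nat.one_le_iff_ne_zero.2 hk0
  have h1 : cos (k * π / m) ≤ cos (π / m) := by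
    refine cos_le_cos_of_nonneg_of_le_pi (by positivity) ?_ ?_
    · rw [div_le_iff₀ hm0]
      nlinarith [pi_pos]
    · gcongr
      nlinarith [pi_pos]
  linarith

theorem isLapEigenvalue_pathGraph_max {m : ℕ} (hm : 2 ≤ m) :
    IsLapEigenvalue (SimpleGraph.pathGraph m) (2 + 2 * cos (π / m)) := by
  refine isLapEigenvalue_pathGraph_iff.2 ⟨m - 1, by omega, ?_⟩
  have hm0 : (m : ℝ) ≠ 0 := by exact_mod_cast (by omega : m ≠ 0)
  rw [Nat.cast_sub (by omega), show ((m : ℝ) - (1 : ℕ)) * π / m = π - π / m by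
    push_cast; field_simp, cos_pi_sub]
  ring

theorem isLapEigenvalue_pathGraph_min {m : ℕ} (hm : 2 ≤ m) :
    IsLapEigenvalue (SimpleGraph.pathGraph m) (2 - 2 * cos (π / m)) :=
  isLapEigenvalue_pathGraph_iff.2 ⟨1, by omega, by simp⟩

theorem two_sub_two_mul_cos_pos {m : ℕ} (hm : 2 ≤ m) : 0 < 2 - 2 * cos (π / m) := by
  have hm0 : (2 : ℝ) ≤ m := by exact_mod_cast hm
  have h0 : 0 < π / m := div_pos pi_pos (by linarith)
  have h1 : π / m ≤ π := div_le_self pi_pos.le (by linarith)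
  have := cos_lt_cos_of_nonneg_of_le_pi le_rfl h1 h0
  rw [cos_zero] at this
  linarith

theorem pathGraph_const_of_isLapEigenfunction_zero {m : ℕ} {f : Fin m → ℝ}
    (h : IsLapEigenfunction (SimpleGraph.pathGraph m) 0 f) (u v : Fin m) : f u = f v := by
  classical
  rw [isLapEigenfunction_iff_mulVec, zero_smul,
    SimpleGraph.lapMatrix_mulVec_eq_zero_iff_forall_reachable] at h
  exact h u v (SimpleGraph.pathGraph_preconnected m u v)

theorem laplacianSpectralRatio_pathGraph {m : ℕ} (hm : 2 ≤ m) :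
    laplacianSpectralRatio (SimpleGraph.pathGraph m) =
      (2 + 2 * cos (π / m)) / (2 - 2 * cos (π / m)) := by
  rw [laplacianSpectralRatio, laplacianEigenvalue_one_eq (isLapEigenvalue_pathGraph_max hm)
      fun _ h => h.le_of_pathGraph,
    laplacianEigenvalue_card_sub_one_eq (fun _ => pathGraph_const_of_isLapEigenfunction_zero)
      (isLapEigenvalue_pathGraph_min hm) (two_sub_two_mul_cos_pos hm).ne'
      fun _ h => h.ge_of_pathGraph]

end Path

/-! ### The spectrum of the star -/

section Star

theorem isLapEigenfunction_star_iff {k : ℕ} {a : ℝ} {f : Fin 1 ⊕ Fin k → ℝ} :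
    IsLapEigenfunction (completeBipartiteGraph (Fin 1) (Fin k)) a f ↔
      ∑ j, (f (.inl 0) - f (.inr j)) = a * f (.inl 0) ∧
        ∀ j, f (.inr j) - f (.inl 0) = a * f (.inr j) := by
  simp [IsLapEigenfunction, completeBipartiteGraph]

theorem IsLapEigenvalue.eq_of_star {k : ℕ} {a : ℝ}
    (h : IsLapEigenvalue (completeBipartiteGraph (Fin 1) (Fin k)) a) :
    a = 0 ∨ a = 1 ∨ a = k + 1 := by
  obtain ⟨f, hf, h⟩ := h
  rw [isLapEigenfunction_star_iff] at h
  obtain ⟨h1, h2⟩ := h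
  by_contra! hne
  obtain ⟨ha0, ha1, hak⟩ := hne
  have hl : ∀ j, (1 - a) * f (.inr j) = f (.inl 0) := fun j => by linear_combination h2 j
  have hc : f (.inl 0) = 0 := by
    have h3 : ∑ j : Fin k, (1 - a) * (f (.inl 0) - f (.inr j)) = (1 - a) * (a * f (.inl 0)) := by
      rw [← Finset.mul_sum, h1]
    simp only [mul_sub, hl] at h3
    rw [Finset.sum_const, Finset.card_univ, Fintype.card_fin, nsmul_eq_mul] at h3
    have h4 : a * (a - (k + 1)) * f (.inl 0) = 0 := by linear_combination h3
    simpa [ha0, sub_eq_zero, hak] using h4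
  refine hf (funext fun x => ?_)
  rcases x with i | j
  · rw [Subsingleton.elim i 0, hc]
    rfl
  · have h5 := hl j
    rw [hc, mul_eq_zero, sub_eq_zero] at h5
    exact h5.resolve_left ha1.symm

theorem laplacianSpectralRatio_star {k : ℕ} (hk : 2 ≤ k) :
    laplacianSpectralRatio (completeBipartiteGraph (Fin 1) (Fin k)) = k + 1 := by
  have hmax : IsLapEigenvalue (completeBipartiteGraph (Fin 1) (Fin k)) (k + 1) := by
    refine ⟨Sum.elim (fun _ => -(k : ℝ)) fun _ => 1, fun h => ?_, ?_⟩
    · simpa using congrFun h (.inr ⟨0, by omega⟩)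
    · rw [isLapEigenfunction_star_iff]
      refine ⟨?_, fun j => ?_⟩
      · simp
        ring
      · simp
        ring
  have hmin : IsLapEigenvalue (completeBipartiteGraph (Fin 1) (Fin k)) 1 := by
    obtain ⟨l, rfl⟩ : ∃ l, k = l + 2 := ⟨k - 2, by omega⟩
    refine ⟨Sum.elim (fun _ => 0) (Fin.cons 1 (Fin.cons (-1) fun _ => 0)), fun h => ?_, ?_⟩
    · simpa using congrFun h (.inr 0)
    · rw [isLapEigenfunction_star_iff]
      refine ⟨?_, fun j => ?_⟩
      · simp [Fin.sum_univ_succ]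
      · simp
  rw [laplacianSpectralRatio, laplacianEigenvalue_one_eq hmax,
    laplacianEigenvalue_card_sub_one_eq _ hmin one_ne_zero, div_one]
  · intro b hb hb0
    have : (0 : ℝ) ≤ k := k.cast_nonneg
    rcases hb.eq_of_star with h | h | h
    · exact absurd h hb0
    · exact h.ge
    · linarith
  · intro f hf
    rw [isLapEigenfunction_star_iff] at hf
    have hc : ∀ x, f x = f (.inl 0) := by
      rintro (i | j)
      · rw [Subsingleton.elim i 0]
      · linear_combination hf.2 j
    exact fun u v => (hc u).trans (hc v).symm
  · intro b hb
    have : (0 : ℝ) ≤ k := k.cast_nonneg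
    rcases hb.eq_of_star with h | h | h <;> linarith

end Star

/-! ### Lifting the spine spectrum to the caterpillar -/

section Caterpillar

open Classical in
theorem isLapEigenfunction_caterpillar_iff {t m : ℕ} {a : ℝ} {f : Fin m × Fin (t + 1) → ℝ} :
    IsLapEigenfunction (caterpillar (t + 2) (m + 1)) a f ↔
      (∀ i, ∑ k, (if (SimpleGraph.pathGraph m).Adj i k then f (i, 0) - f (k, 0) else 0) +
          ∑ j : Fin t, (f (i, 0) - f (i, j.succ)) = a * f (i, 0)) ∧
        ∀ i, ∀ j : Fin t, f (i, j.succ) - f (i, 0) = a * f (i, j.succ) := by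
  have hspine : ∀ i : Fin m, ∑ w : Fin m × Fin (t + 1),
      (if (caterpillar (t + 2) (m + 1)).Adj (i, (0 : Fin (t + 1))) w then f (i, 0) - f w else 0) =
      ∑ k, (if (SimpleGraph.pathGraph m).Adj i k then f (i, 0) - f (k, 0) else 0) +
        ∑ j : Fin t, (f (i, 0) - f (i, j.succ)) := by
    intro i
    rw [Fintype.sum_prod_type]
    simp only [Fin.sum_univ_succ]
    rw [Finset.sum_add_distrib]
    congr 1
    · simp [caterpillar, SimpleGraph.pathGraph_adj]
    · rw [Finset.sum_comm]
      simp [caterpillar]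
  have hleaf : ∀ (i : Fin m) (j : Fin t), ∑ w : Fin m × Fin (t + 1),
      (if (caterpillar (t + 2) (m + 1)).Adj (i, j.succ) w then f (i, j.succ) - f w else 0) =
      f (i, j.succ) - f (i, 0) := by
    intro i j
    rw [Fintype.sum_prod_type]
    simp only [Fin.sum_univ_succ]
    rw [Finset.sum_add_distrib]
    simp [caterpillar]
  constructor
  · intro h
    exact ⟨fun i => (hspine i).symm.trans (h (i, (0 : Fin (t + 1)))),
      fun i j => (hleaf i j).symm.trans (h (i, j.succ))⟩
  · rintro ⟨h1, h2⟩ ⟨i, j⟩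
    refine Fin.cases (n := t) ?_ (fun j => ?_) j
    · exact (hspine i).trans (h1 i)
    · exact (hleaf i j).trans (h2 i j)

/-- A Laplacian eigenvalue of the caterpillar different from `1` solves a quadratic equation
over a Laplacian eigenvalue of its spine. -/
theorem IsLapEigenvalue.exists_of_caterpillar {t m : ℕ} {a : ℝ}
    (h : IsLapEigenvalue (caterpillar (t + 2) (m + 1)) a) (ha : a ≠ 1) :
    ∃ θ, IsLapEigenvalue (SimpleGraph.pathGraph m) θ ∧ a ^ 2 - (t + 1 + θ) * a + θ = 0 := by
  classical
  obtain ⟨f, hf, h⟩ := h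
  obtain ⟨h1, h2⟩ := isLapEigenfunction_caterpillar_iff.1 h
  have ha' : a - 1 ≠ 0 := sub_ne_zero.2 ha
  have hl : ∀ i, ∀ j : Fin t, (1 - a) * f (i, j.succ) = f (i, (0 : Fin (t + 1))) :=
    fun i j => by linear_combination h2 i j
  refine ⟨a * (a - (t + 1)) / (a - 1), ⟨fun i => f (i, (0 : Fin (t + 1))), fun h0 => ?_,
    fun i => ?_⟩, by field_simp; ring⟩
  · refine hf (funext fun ⟨i, j⟩ => ?_)
    refine Fin.cases (n := t) ?_ (fun j => ?_) j
    · exact congrFun h0 i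
    · have h3 := hl i j
      rw [show f (i, (0 : Fin (t + 1))) = 0 from congrFun h0 i, mul_eq_zero] at h3
      exact h3.resolve_left fun h4 => ha' (by linear_combination -h4)
  · have h3 : ∑ j : Fin t, (1 - a) * (f (i, (0 : Fin (t + 1))) - f (i, j.succ)) =
        t * (-a * f (i, (0 : Fin (t + 1)))) := by
      simp only [mul_sub, hl]
      rw [Finset.sum_const, Finset.card_univ, Fintype.card_fin, nsmul_eq_mul]
      ring
    rw [← Finset.mul_sum] at h3
    have h4 := h1 i
    refine mul_left_cancel₀ ha' ?_
    rw [eq_sub_of_add_eq h4]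
    field_simp
    linear_combination h3

theorem isLapEigenvalue_caterpillar {t m : ℕ} (ht : 0 < t) {a θ : ℝ}
    (hθ : IsLapEigenvalue (SimpleGraph.pathGraph m) θ) (h : a ^ 2 - (t + 1 + θ) * a + θ = 0) :
    IsLapEigenvalue (caterpillar (t + 2) (m + 1)) a := by
  classical
  obtain ⟨c, hc, hcθ⟩ := hθ
  -- Scaling the spine by `1 - a` avoids dividing on the leaves; a leaf exists since `0 < t`, so `f
  -- ≠ 0`.
  let f : Fin m × Fin (t + 1) → ℝ := fun x => if x.2 = 0 then (1 - a) * c x.1 else c x.1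
  have hf0 : ∀ i, f (i, 0) = (1 - a) * c i := fun i => if_pos rfl
  have hf1 : ∀ i, ∀ j : Fin t, f (i, j.succ) = c i := fun i j => if_neg (Fin.succ_ne_zero j)
  refine ⟨f, fun h0 => hc (funext fun i => ?_), isLapEigenfunction_caterpillar_iff.2
    ⟨fun i => ?_, fun i j => ?_⟩⟩
  · rw [← hf1 i ⟨0, ht⟩]
    exact congrFun h0 _
  · have h1 := hcθ i
    have h2 : ∑ k, (if (SimpleGraph.pathGraph m).Adj i k then f (i, 0) - f (k, 0) else 0) =
        (1 - a) * (θ * c i) := by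
      rw [← h1, Finset.mul_sum]
      refine Finset.sum_congr rfl fun k _ => ?_
      rw [hf0, hf0]
      split_ifs <;> ring
    rw [h2]
    simp only [hf0, hf1]
    rw [Finset.sum_const, Finset.card_univ, Fintype.card_fin, nsmul_eq_mul]
    linear_combination c i * h
  · rw [hf0, hf1]
    ring

end Caterpillar

/-! ### The caterpillar ratio and its estimates -/

section CaterpillarRatio

open Real

/-- The quadratic equation that lifts a Laplacian eigenvalue of the spine has one root on each
side of `1`. -/
theorem exists_roots_of_one_lt {s θ : ℝ} (hs : 1 < s) (hθ : 0 < θ) :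
    ∃ x y, 0 < x ∧ x < 1 ∧ 1 < y ∧ x * y = θ ∧ x + y = s + θ := by
  have hd : 0 ≤ (s + θ) ^ 2 - 4 * θ := by nlinarith [sq_nonneg (s + θ - 2)]
  have hr := sq_sqrt hd
  -- This says that `1` lies strictly between the roots; the squares differ by `4 * (s - 1)`.
  have h1 : |s + θ - 2| < √((s + θ) ^ 2 - 4 * θ) := by
    rw [← sqrt_sq_eq_abs]
    exact sqrt_lt_sqrt (sq_nonneg _) (by nlinarith)
  have h2 : √((s + θ) ^ 2 - 4 * θ) < s + θ := by
    rw [sqrt_lt' (by linarith)]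
    linarith
  obtain ⟨h3, h4⟩ := abs_lt.1 h1
  refine ⟨(s + θ - √((s + θ) ^ 2 - 4 * θ)) / 2, (s + θ + √((s + θ) ^ 2 - 4 * θ)) / 2,
    by linarith, by linarith, by linarith, by linear_combination -hr / 4, by ring⟩

theorem caterpillar_const_of_isLapEigenfunction_zero {t m : ℕ} {f : Fin m × Fin (t + 1) → ℝ}
    (h : IsLapEigenfunction (caterpillar (t + 2) (m + 1)) 0 f) (u v : Fin m × Fin (t + 1)) :
    f u = f v := by
  obtain ⟨h1, h2⟩ := isLapEigenfunction_caterpillar_iff.1 h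
  have hl : ∀ i, ∀ j : Fin t, f (i, j.succ) = f (i, 0) :=
    fun i j => by linear_combination h2 i j
  have hs : ∀ x, f x = f (x.1, 0) := by
    rintro ⟨i, j⟩
    exact Fin.cases (n := t) rfl (fun j => hl i j) j
  have hp : IsLapEigenfunction (SimpleGraph.pathGraph m) 0 fun i => f (i, 0) := by
    intro i
    have h3 := h1 i
    simp only [hl, sub_self, Finset.sum_const_zero, add_zero] at h3
    exact h3
  rw [hs u, hs v]
  exact pathGraph_const_of_isLapEigenfunction_zero hp u.1 v.1

/-- The spectral ratio of the caterpillar is `x * y / θ`, where `x` and `y` are the larger roots of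
the quadratic equations over the largest and over the least positive eigenvalue of the spine, and
`θ` is the latter. -/
theorem laplacianSpectralRatio_caterpillar {t m : ℕ} (ht : 0 < t) (hm : 2 ≤ m) :
    ∃ x y : ℝ, 1 < x ∧ 1 < y ∧
      t + (2 + 2 * cos (π / m)) < x ∧ x < t + 1 + (2 + 2 * cos (π / m)) ∧
      t + (2 - 2 * cos (π / m)) < y ∧ y < t + 1 + (2 - 2 * cos (π / m)) ∧
      x ^ 2 - (t + 1 + (2 + 2 * cos (π / m))) * x + (2 + 2 * cos (π / m)) = 0 ∧
      y ^ 2 - (t + 1 + (2 - 2 * cos (π / m))) * y + (2 - 2 * cos (π / m)) = 0 ∧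
      laplacianSpectralRatio (caterpillar (t + 2) (m + 1)) =
        x * y / (2 - 2 * cos (π / m)) := by
  have ht1 : (1 : ℝ) ≤ t := by exact_mod_cast ht
  have hp := two_sub_two_mul_cos_pos hm
  have hP := isLapEigenvalue_pathGraph_max hm
  have hp' := isLapEigenvalue_pathGraph_min hm
  have hge := fun θ (h : IsLapEigenvalue (SimpleGraph.pathGraph m) θ) (h0 : θ ≠ 0) =>
    h.ge_of_pathGraph h0
  have hle := fun θ (h : IsLapEigenvalue (SimpleGraph.pathGraph m) θ) => h.le_of_pathGraph
  have hpP := hle _ hp'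
  generalize 2 + 2 * cos (π / m) = Θ at *
  generalize 2 - 2 * cos (π / m) = θ at *
  obtain ⟨z, x, hz0, hz1, hx1, hzx, hzx'⟩ :=
    exists_roots_of_one_lt (s := (t : ℝ) + 1) (by linarith) (hp.trans_le hpP)
  obtain ⟨w, y, hw0, hw1, hy1, hwy, hwy'⟩ :=
    exists_roots_of_one_lt (s := (t : ℝ) + 1) (by linarith) hp
  have hxq : x ^ 2 - (t + 1 + Θ) * x + Θ = 0 := by rw [← hzx', ← hzx]; ring
  have hyq : y ^ 2 - (t + 1 + θ) * y + θ = 0 := by rw [← hwy', ← hwy]; ring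
  have hwq : w ^ 2 - (t + 1 + θ) * w + θ = 0 := by rw [← hwy', ← hwy]; ring
  have hmax : ∀ b, IsLapEigenvalue (caterpillar (t + 2) (m + 1)) b → b ≤ x := by
    intro b hb
    by_contra! hxb
    obtain ⟨η, hη, hq⟩ := hb.exists_of_caterpillar (by linarith)
    -- For `b > 1` the quadratic decreases in `η`, so `η ≤ Θ` forces `(b - x) * (b - z) ≤ 0`.
    nlinarith [mul_nonneg (sub_nonneg.2 (hle η hη)) (by linarith : 0 ≤ b - 1),
      mul_pos (sub_pos.2 hxb) (by linarith : 0 < b - z)]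
  have hmin : ∀ b, IsLapEigenvalue (caterpillar (t + 2) (m + 1)) b → b ≠ 0 → w ≤ b := by
    intro b hb hb0
    by_contra! hbw
    have hbpos := lt_of_le_of_ne hb.nonneg hb0.symm
    obtain ⟨η, hη, hq⟩ := hb.exists_of_caterpillar (by linarith)
    rcases eq_or_ne η 0 with rfl | hη0
    · nlinarith
    -- For `b < 1` it increases in `η`, so `η ≥ θ` forces `(b - w) * (b - y) ≤ 0`.
    · nlinarith [mul_nonneg (sub_nonneg.2 (hge η hη hη0)) (by linarith : 0 ≤ 1 - b),
        mul_pos (sub_pos.2 hbw) (by linarith : 0 < y - b)]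
  refine ⟨x, y, hx1, hy1, by linarith, by linarith, by linarith, by linarith, hxq, hyq, ?_⟩
  rw [laplacianSpectralRatio,
    laplacianEigenvalue_one_eq (isLapEigenvalue_caterpillar ht hP hxq) hmax]
  have h2 := laplacianEigenvalue_card_sub_one_eq (G := caterpillar (t + 2) (m + 1))
    (fun f => caterpillar_const_of_isLapEigenfunction_zero (f := f))
    (isLapEigenvalue_caterpillar ht hp' hwq) hw0.ne' hmin
  rw [h2, div_eq_div_iff hw0.ne' hp.ne', ← hwy]
  ring

theorem two_sub_two_mul_cos_le_sq (x : ℝ) : 2 - 2 * cos x ≤ x ^ 2 := by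
  linarith [one_sub_sq_div_two_le_cos (x := x)]

theorem mul_sq_le_two_sub_two_mul_cos {x : ℝ} (hx0 : 0 < x) (hx : x ≤ π / 2) :
    0.8 * x ^ 2 ≤ 2 - 2 * cos x := by
  have h1 := sin_gt_sub_cube (x := x / 2) (by positivity)
  have h2 : 2 - 2 * cos x = 4 * sin (x / 2) ^ 2 := by
    rw [show x = 2 * (x / 2) by ring, cos_two_mul, sin_sq]
    ring_nf
  have hx2 : x ^ 2 ≤ 2.468 := by nlinarith [pi_lt_d4]
  have h3 : 0.897 * (x / 2) ≤ sin (x / 2) := by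
    nlinarith [mul_nonneg hx0.le (sub_nonneg.2 hx2)]
  rw [h2]
  nlinarith

theorem star_lt_caterpillar {t m : ℕ} (ht : 0 < t) (hm : 2 ≤ m) :
    ((t : ℝ) + 1) * m < laplacianSpectralRatio (caterpillar (t + 2) (m + 1)) := by
  obtain ⟨x, y, -, -, hx, -, hy, -, -, -, h⟩ := laplacianSpectralRatio_caterpillar ht hm
  have ht1 : (1 : ℝ) ≤ t := by exact_mod_cast ht
  have hp := two_sub_two_mul_cos_pos hm
  rw [h, lt_div_iff₀ hp]
  have hc := neg_one_le_cos (π / m)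
  refine lt_of_le_of_lt ?_ (mul_lt_mul'' hx hy (by linarith) (by linarith))
  rcases (by omega : m = 2 ∨ m = 3 ∨ 4 ≤ m) with rfl | rfl | hm4
  · simp only [Nat.cast_ofNat, cos_pi_div_two]
    nlinarith
  · simp only [Nat.cast_ofNat, cos_pi_div_three]
    nlinarith
  · have hm4' : (4 : ℝ) ≤ m := by exact_mod_cast hm4
    have h1 := two_sub_two_mul_cos_le_sq (π / m)
    -- The constant is tight: `2.5 * (t + 1) ≤ t ^ 2 + 4 * t` is an equality at `t = 1`.
    have h2 : m * (2 - 2 * cos (π / m)) ≤ 2.5 := by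
      calc m * (2 - 2 * cos (π / m)) ≤ m * (π / m) ^ 2 := by gcongr
        _ = π ^ 2 / m := by field_simp
        _ ≤ 10 / 4 := by
          gcongr
          nlinarith [pi_lt_d4, pi_pos]
        _ = 2.5 := by norm_num
    nlinarith [mul_nonneg (by linarith : 0 ≤ 2 + 2 * cos (π / m)) hp.le,
      mul_le_mul_of_nonneg_left h2 (by linarith : (0 : ℝ) ≤ t + 1)]

/-- The upper estimate of the spectral ratio of a caterpillar with at least two pendant vertices
at each spine vertex, in terms of the angle `x = π / m`. -/
theorem ratio_estimate_of_three_le {s x : ℝ} (hs : 3 ≤ s) (hx0 : 0 < x) (hx : x ≤ π / 2)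
    (hp : 0 < 2 - 2 * cos x) (hq : 0 < 2 - 2 * cos (x / s)) :
    (s + (2 + 2 * cos x)) * (s + (2 - 2 * cos x)) / (2 - 2 * cos x) ≤
      (2 + 2 * cos (x / s)) / (2 - 2 * cos (x / s)) := by
  have h1 := mul_sq_le_two_sub_two_mul_cos hx0 hx
  have h2 := two_sub_two_mul_cos_le_sq (x / s)
  have hcos : 0 ≤ cos x := cos_nonneg_of_mem_Icc ⟨by linarith, hx⟩
  have hs2 : 0 < s ^ 2 := by positivity
  rw [div_pow, le_div_iff₀ hs2] at h2
  rw [div_le_div_iff₀ hp hq]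
  generalize cos (x / s) = d at *
  generalize cos x = c at *
  -- Here `3.2 = 4 * 0.8` matches the cosine bound `h1`, and `s ≥ 3` leaves `2.2 * s ^ 2` for the
  -- lower-order terms.
  have h3 : 4 * s + 6 ≤ 2.2 * s ^ 2 := by nlinarith
  have key : (s + (2 + 2 * c)) * (s + (2 - 2 * c)) + (2 - 2 * c) ≤ 3.2 * s ^ 2 := by
    linarith [sq_nonneg c]
  linarith [mul_le_mul_of_nonneg_right key hq.le]

/-- The upper estimate of the spectral ratio of a caterpillar with one pendant vertex at each of
at least four spine vertices, in terms of the angle `x = π / (2 * m)`. -/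
theorem ratio_estimate_of_eq_two {x : ℝ} (hx0 : 0 ≤ x) (hx : x ≤ π / 8)
    (hp : 0 < 2 - 2 * cos (2 * x)) (hq : 0 < 2 - 2 * cos x) :
    (2 + (2 + 2 * cos (2 * x))) * (2 + (2 - 2 * cos (2 * x))) / (2 - 2 * cos (2 * x)) ≤
      (2 + 2 * cos x) / (2 - 2 * cos x) := by
  have hlow := one_sub_sq_div_two_le_cos (x := x)
  have hx' : x ≤ 0.3927 := by linarith [pi_lt_d4]
  have hc : 0.92 ≤ cos x := by nlinarith
  rw [cos_two_mul] at hp ⊢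
  rw [div_le_div_iff₀ hp hq]
  clear hlow hp
  generalize cos x = c at *
  obtain ⟨d, rfl⟩ : ∃ d, c = 1 - d := ⟨1 - c, by ring⟩
  have hd : 0 ≤ d := by linarith
  have hd2 : d ≤ 0.08 := by linarith
  -- This is the cross-multiplied goal divided by `2 * d`; it follows from `12 * d ≤ 1`.
  have key : 12 + 16 * (1 - d) ^ 2 * (d * (2 - d)) ≤ 4 * (2 - d) ^ 2 := by
    have : (1 - d) ^ 2 * (d * (2 - d)) ≤ 1 * (2 * d) :=
      mul_le_mul (by nlinarith) (by nlinarith) (by nlinarith) zero_le_one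
    nlinarith
  linarith [mul_le_mul_of_nonneg_left key hd]

theorem caterpillar_lt_path {t m : ℕ} (ht : 0 < t) (hm : 2 ≤ m) (h5 : 5 ≤ (t + 1) * m) :
    laplacianSpectralRatio (caterpillar (t + 2) (m + 1)) <
      laplacianSpectralRatio (SimpleGraph.pathGraph ((t + 1) * m)) := by
  obtain ⟨x, y, hx1, hy1, -, hx, -, hy, hxq, hyq, h⟩ := laplacianSpectralRatio_caterpillar ht hm
  have hp := two_sub_two_mul_cos_pos hm
  have hq := two_sub_two_mul_cos_pos (by omega : 2 ≤ (t + 1) * m)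
  have hm2 : (2 : ℝ) ≤ m := by exact_mod_cast hm
  rw [h, laplacianSpectralRatio_pathGraph (by omega)]
  have hn : π / (((t + 1) * m : ℕ) : ℝ) = π / m / (t + 1) := by
    push_cast
    rw [div_div, mul_comm]
  rw [hn] at hq ⊢
  have hxy : x * y < (t + 1 + (2 + 2 * cos (π / m))) * (t + 1 + (2 - 2 * cos (π / m))) :=
    mul_lt_mul'' hx hy (by linarith) (by linarith)
  have hcases : (t = 1 ∧ m = 3) ∨ (t = 1 ∧ 4 ≤ m) ∨ 2 ≤ t := by
    rcases (by omega : t = 1 ∨ 2 ≤ t) with rfl | h2 <;> omega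
  rcases hcases with ⟨rfl, rfl⟩ | ⟨rfl, hm4⟩ | ht2
  -- For `n = 6` the bound `hxy` gives only `15`, above the path ratio of about `13.9`; the roots
  -- are `x ≈ 4.303` and `y ≈ 2.618`.
  · simp only [Nat.cast_ofNat, Nat.cast_one, cos_pi_div_three] at *
    rw [show π / 3 / (1 + 1) = π / 6 by ring, cos_pi_div_six] at *
    have h3 : 1.73 < √3 := lt_sqrt_of_sq_lt (by norm_num)
    have hx' : x < 4.31 := by nlinarith
    have hy' : y < 2.62 := by nlinarith
    rw [lt_div_iff₀ hq]
    have hxy' : x * y < 4.31 * 2.62 := mul_lt_mul'' hx' hy' (by linarith) (by linarith)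
    nlinarith
  · refine (div_lt_div_of_pos_right hxy hp).trans_le ?_
    have hm4' : (4 : ℝ) ≤ m := by exact_mod_cast hm4
    have hx8 : π / m / 2 ≤ π / 8 := by
      rw [div_div]
      gcongr
      linarith
    have e : π / m = 2 * (π / m / 2) := by ring
    rw [Nat.cast_one, one_add_one_eq_two] at *
    have := ratio_estimate_of_eq_two (by positivity) hx8 (e ▸ hp) hq
    rwa [← e] at this
  · refine (div_lt_div_of_pos_right hxy hp).trans_le ?_
    have ht2' : (2 : ℝ) ≤ t := by exact_mod_cast ht2
    exact ratio_estimate_of_three_le (by linarith) (by positivity) (by gcongr) hp hq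

end CaterpillarRatio

theorem corollary5p1 (n Δ D : ℕ) (hΔ : 3 ≤ Δ) (hD : 3 ≤ D)
    (hn : (Δ - 1) * (D - 1) = n) (hn5 : 5 ≤ n) :
    laplacianSpectralRatio (completeBipartiteGraph (Fin 1) (Fin (n - 1))) <
        laplacianSpectralRatio (caterpillar Δ D) ∧
      laplacianSpectralRatio (caterpillar Δ D) <
        laplacianSpectralRatio (SimpleGraph.pathGraph n) := by
  obtain ⟨t, rfl⟩ : ∃ t, Δ = t + 2 := ⟨Δ - 2, by omega⟩
  obtain ⟨m, rfl⟩ : ∃ m, D = m + 1 := ⟨D - 1, by omega⟩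
  have hn' : n = (t + 1) * m := hn.symm
  refine ⟨?_, ?_⟩
  · rw [laplacianSpectralRatio_star (by omega), Nat.cast_sub (by omega), Nat.cast_one,
      sub_add_cancel, hn']
    push_cast
    exact star_lt_caterpillar (by omega) (by omega)
  · rw [hn']
    exact caterpillar_lt_path (by omega) (by omega) (hn' ▸ hn5)
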